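/- Let $X$ be a real Banach space. Let $X^{\#}=\mathrm{Lip}_0(X,\mathbb R)$ be the Banach space of all Lipschitz functions $f:X\to\mathbb R$ with $f(0)=0$, with the norm $\mathrm{Lip}(f)=\sup_{x\ne y}\frac{|f(x)-f(y)|}{\|x-y\|}$, and let $F(X)$ be the Lipschitz-free space of $X$, that is, the norm closure in $(X^{\#})^{*}$ of the linear span of the evaluation functionals $\delta_x:f\mapsto f(x)$, $x\in X$. A Banach space $E$ has the *approximation property* if the identity of $E$ lies in the closure, in the topology of uniform convergence on compact subsets of $E$, of the set of bounded finite-rank linear operators $E\to E$. The space $X$ has the *Lipschitz approximation property* if the identity of $X$ lies in the closure, in the topology of uniform convergence on compact subsets of $X$, of the set of Lipschitz maps $f:X\to X$ with $f(0)=0$ whose range spans a finite-dimensional subspace. Then the following hold. 1. If $F(X)$ has the approximation property, then $X$ has the Lipschitz approximation property. 2. If $X^{\#}$ has the approximation property, then $X$ has the Lipschitz approximation property. -/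

import Mathlib

open scoped Topology UniformConvergence CompactConvergenceCLM

/-- The linear subspace of `X → Y` of all Lipschitz maps vanishing at `0`. -/
def lipZeroSubmodule (X Y : Type*) [NormedAddCommGroup X]
    [NormedAddCommGroup Y] [NormedSpace ℝ Y] : Submodule ℝ (X → Y) where
  carrier := {f | (∃ c : ℝ, 0 ≤ c ∧ ∀ x₁ x₂, ‖f x₁ - f x₂‖ ≤ c * ‖x₁ - x₂‖) ∧ f 0 = 0}
  zero_mem' := ⟨⟨0, le_rfl, by simp⟩, rfl⟩
  add_mem' := by
    rintro f g ⟨⟨a, ha, hf⟩, hf0⟩ ⟨⟨b, hb, hg⟩, hg0⟩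
    refine ⟨⟨a + b, add_nonneg ha hb, fun x₁ x₂ => ?_⟩, by simp [hf0, hg0]⟩
    calc ‖(f + g) x₁ - (f + g) x₂‖ = ‖(f x₁ - f x₂) + (g x₁ - g x₂)‖ := by
          congr 1; simp only [Pi.add_apply]; abel
      _ ≤ ‖f x₁ - f x₂‖ + ‖g x₁ - g x₂‖ := norm_add_le _ _
      _ ≤ (a + b) * ‖x₁ - x₂‖ := by rw [add_mul]; exact add_le_add (hf _ _) (hg _ _)
  smul_mem' := by
    rintro r f ⟨⟨a, ha, hf⟩, hf0⟩
    refine ⟨⟨‖r‖ * a, by positivity, fun x₁ x₂ => ?_⟩, by simp [hf0]⟩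
    rw [Pi.smul_apply, Pi.smul_apply, ← smul_sub, norm_smul, mul_assoc]
    exact mul_le_mul_of_nonneg_left (hf _ _) (norm_nonneg _)

/-- The space `Lip₀(X, Y)` of Lipschitz maps `f : X → Y` with `f 0 = 0`, as a type of its own
(so that it carries the Lipschitz norm below and not the topology of pointwise convergence). -/
def LipZero (X Y : Type*) [NormedAddCommGroup X]
    [NormedAddCommGroup Y] [NormedSpace ℝ Y] : Type _ := ↥(lipZeroSubmodule X Y)

namespace LipZero

section

variable {X Y : Type*} [NormedAddCommGroup X] [NormedAddCommGroup Y] [NormedSpace ℝ Y]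

instance : AddCommGroup (LipZero X Y) := inferInstanceAs (AddCommGroup ↥(lipZeroSubmodule X Y))

instance : Module ℝ (LipZero X Y) := inferInstanceAs (Module ℝ ↥(lipZeroSubmodule X Y))

instance : FunLike (LipZero X Y) X Y where
  coe f := f.1
  coe_injective _ _ h := Subtype.ext h

@[ext] theorem ext {f g : LipZero X Y} (h : ∀ x, f x = g x) : f = g := DFunLike.ext _ _ h

@[simp] theorem zero_apply (x : X) : (0 : LipZero X Y) x = 0 := rfl
@[simp] theorem add_apply (f g : LipZero X Y) (x : X) : (f + g) x = f x + g x := rfl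
@[simp] theorem smul_apply (r : ℝ) (f : LipZero X Y) (x : X) : (r • f) x = r • f x := rfl
@[simp] theorem map_zero (f : LipZero X Y) : f 0 = 0 := f.2.2

/-- The Lipschitz norm: the supremum of `‖f x₁ - f x₂‖ / ‖x₁ - x₂‖` over `x₁ ≠ x₂`
(the pairs with `x₁ = x₂` contribute the value `0 / 0 = 0`). -/
noncomputable instance : Norm (LipZero X Y) where
  norm f := ⨆ p : X × X, ‖f p.1 - f p.2‖ / ‖p.1 - p.2‖

theorem norm_def (f : LipZero X Y) :
    ‖f‖ = ⨆ p : X × X, ‖f p.1 - f p.2‖ / ‖p.1 - p.2‖ := rfl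

theorem bddAbove (f : LipZero X Y) :
    BddAbove (Set.range fun p : X × X => ‖f p.1 - f p.2‖ / ‖p.1 - p.2‖) := by
  obtain ⟨⟨c, hc, hf⟩, -⟩ := f.2
  refine ⟨c, ?_⟩
  rintro _ ⟨p, rfl⟩
  exact div_le_of_le_mul₀ (norm_nonneg _) hc (hf _ _)

theorem norm_sub_le (f : LipZero X Y) (x₁ x₂ : X) : ‖f x₁ - f x₂‖ ≤ ‖f‖ * ‖x₁ - x₂‖ := by
  rcases eq_or_ne x₁ x₂ with rfl | h
  · simp
  · rw [← div_le_iff₀ (norm_pos_iff.2 (sub_ne_zero.2 h))]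
    exact le_ciSup f.bddAbove (x₁, x₂)

theorem norm_le (f : LipZero X Y) {c : ℝ} (hc : 0 ≤ c)
    (h : ∀ x₁ x₂, ‖f x₁ - f x₂‖ ≤ c * ‖x₁ - x₂‖) : ‖f‖ ≤ c :=
  ciSup_le fun _ => div_le_of_le_mul₀ (norm_nonneg _) hc (h _ _)

theorem norm_nonneg' (f : LipZero X Y) : 0 ≤ ‖f‖ :=
  Real.iSup_nonneg fun _ => by positivity

theorem norm_apply_le (f : LipZero X Y) (x : X) : ‖f x‖ ≤ ‖f‖ * ‖x‖ := by
  simpa using f.norm_sub_le x 0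

theorem normCore : NormedSpace.Core ℝ (LipZero X Y) where
  norm_nonneg := norm_nonneg'
  norm_smul r f := by
    have key : ∀ (s : ℝ) (g : LipZero X Y), ‖s • g‖ ≤ ‖s‖ * ‖g‖ := fun s g =>
      norm_le _ (mul_nonneg (norm_nonneg _) g.norm_nonneg') fun x₁ x₂ => by
        rw [smul_apply, smul_apply, ← smul_sub, norm_smul, mul_assoc]
        exact mul_le_mul_of_nonneg_left (g.norm_sub_le _ _) (norm_nonneg _)
    refine le_antisymm (key r f) ?_
    rcases eq_or_ne r 0 with rfl | hr
    · simpa using norm_nonneg' _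
    · have h := key r⁻¹ (r • f)
      rw [inv_smul_smul₀ hr, norm_inv] at h
      rwa [← le_inv_mul_iff₀ (norm_pos_iff.2 hr)]
  norm_triangle f g :=
    norm_le _ (add_nonneg f.norm_nonneg' g.norm_nonneg') fun x₁ x₂ => by
      rw [add_apply, add_apply, add_sub_add_comm, add_mul]
      exact (norm_add_le _ _).trans (add_le_add (f.norm_sub_le _ _) (g.norm_sub_le _ _))
  norm_eq_zero_iff f := by
    constructor
    · intro h
      ext x
      have := f.norm_apply_le x
      rw [h, zero_mul] at this
      simpa using this
    · rintro rfl
      exact le_antisymm (norm_le _ le_rfl (by simp)) (norm_nonneg' _)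

noncomputable instance : NormedAddCommGroup (LipZero X Y) := NormedAddCommGroup.ofCore normCore

noncomputable instance : NormedSpace ℝ (LipZero X Y) := NormedSpace.ofCore normCore

/-- The set of Lipschitz finite-rank operators in `Lip₀(X, Y)`: the linear span of the range
is finite-dimensional. -/
def finiteRank (X Y : Type*) [NormedAddCommGroup X] [NormedAddCommGroup Y] [NormedSpace ℝ Y] :
    Set (LipZero X Y) :=
  {f | FiniteDimensional ℝ (Submodule.span ℝ (Set.range f))}

/-- The topology of uniform convergence on compact subsets of `X`, on `Lip₀(X, Y)`. -/
@[reducible] def compactConvergence (X Y : Type*) [NormedAddCommGroup X]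
    [NormedAddCommGroup Y] [NormedSpace ℝ Y] : TopologicalSpace (LipZero X Y) :=
  TopologicalSpace.induced
    (fun f => (UniformOnFun.ofFun {K : Set X | IsCompact K} f : X →ᵤ[{K | IsCompact K}] Y))
    inferInstance

/-- The identity map of `X` as an element of `Lip₀(X, X)`. -/
def identity (X : Type*) [NormedAddCommGroup X] [NormedSpace ℝ X] : LipZero X X :=
  ⟨fun x => x, ⟨1, zero_le_one, by simp⟩, rfl⟩

/-- The evaluation functional `δ_x : X^# → ℝ`, `f ↦ f x`, on `X^# = Lip₀(X, ℝ)`. -/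
noncomputable def delta (x : X) : StrongDual ℝ (LipZero X ℝ) :=
  LinearMap.mkContinuous
    { toFun := fun f => f x
      map_add' := fun _ _ => rfl
      map_smul' := fun _ _ => rfl } ‖x‖
    fun f => (f.norm_apply_le x).trans_eq (mul_comm _ _)

end

end LipZero

/-- The Lipschitz-free space `F(X)`: the norm closure in `(X^#)^*` of the linear span of the
evaluation functionals. -/
noncomputable def LipFree (X : Type*) [NormedAddCommGroup X] :
    Submodule ℝ (StrongDual ℝ (LipZero X ℝ)) :=
  (Submodule.span ℝ (Set.range (LipZero.delta (X := X)))).topologicalClosure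

/-- The identification of `L(E, E)` with its copy carrying the topology of uniform convergence
on compact subsets of `E`. -/
noncomputable def toCompactConvergence (E : Type*) [NormedAddCommGroup E] [NormedSpace ℝ E] :
    (E →L[ℝ] E) ≃ₗ[ℝ] (E →L_c[ℝ] E) :=
  ContinuousLinearMap.toUniformConvergenceCLM (RingHom.id ℝ) E {K : Set E | IsCompact K}

/-- The approximation property: the identity lies in the closure of the bounded finite-rank
linear operators, in `L(E, E)` with the topology of uniform convergence on compact sets. -/
def HasAP (E : Type*) [NormedAddCommGroup E] [NormedSpace ℝ E] : Prop :=
  toCompactConvergence E (ContinuousLinearMap.id ℝ E) ∈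
    closure (toCompactConvergence E '' {T | FiniteDimensional ℝ (LinearMap.range T.toLinearMap)})

/-- The Lipschitz approximation property: the identity lies in the closure of the Lipschitz
finite-rank operators, in `Lip₀(X, X)` with the topology of uniform convergence on compact
sets. -/
def HasLipAP (X : Type*) [NormedAddCommGroup X] [NormedSpace ℝ X] : Prop :=
  LipZero.identity X ∈ closure[LipZero.compactConvergence X X] (LipZero.finiteRank X X)

/-! ### Closures for compact convergence -/

open Filter Set

/-! Since `X` is complete, the 1-Lipschitz embedding `δ : X → F(X)` has a bounded linear left
inverse `β`, the barycenter map. If a finite-rank `T` is close to the identity on the compact set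
`δ(K)`, then `β ∘ T ∘ δ` is Lipschitz, of finite rank and close to the identity on `K`; this is the
first claim (`HasAP.hasLipAP`).

The second reduces to it: `X^#` is the dual of `F(X)` (`dualEquiv`), and the approximation property
passes from a dual `E*` to `E` (`HasAP.of_dual`, Grothendieck). If it fails for `E`, Hahn–Banach in
`c₀(E)` yields a nuclear tensor `∑ aᵢ ⊗ zᵢ` that annihilates the rank-one operators but has nonzero
trace `∑ aᵢ(zᵢ)`. The approximation property of `E*` forces this trace to vanish
(`HasAP.tsum_apply_eq_zero`). -/

theorem mem_closure_induced_compactConvergence_iff {A X Y : Type*} [TopologicalSpace X]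
    [NormedAddCommGroup Y] (G : A → (X →ᵤ[{K : Set X | IsCompact K}] Y)) (S : Set A) (a : A) :
    a ∈ closure[TopologicalSpace.induced G inferInstance] S ↔
      ∀ K : Set X, IsCompact K → ∀ ε > 0, ∃ b ∈ S, ∀ x ∈ K,
        ‖UniformOnFun.toFun _ (G b) x - UniformOnFun.toFun _ (G a) x‖ < ε := by
  rw [closure_induced, mem_closure_iff_nhds_basis (UniformOnFun.hasBasis_nhds_of_basis X Y
    {K : Set X | IsCompact K} (G a) ⟨∅, isCompact_empty⟩
    (fun s hs t ht => ⟨s ∪ t, hs.union ht, subset_union_left, subset_union_right⟩)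
    Metric.uniformity_basis_dist)]
  constructor
  · intro h K hK ε hε
    obtain ⟨_, ⟨b, hb, rfl⟩, h⟩ := h (K, ε) ⟨hK, hε⟩
    refine ⟨b, hb, fun x hx => ?_⟩
    rw [← dist_eq_norm]
    exact h x hx
  · rintro h ⟨K, ε⟩ ⟨hK, hε⟩
    obtain ⟨b, hb, h⟩ := h K hK ε hε
    refine ⟨_, ⟨b, hb, rfl⟩, fun x hx => ?_⟩
    change dist _ _ < ε
    rw [dist_eq_norm]
    exact h x hx

theorem hasAP_iff (E : Type*) [NormedAddCommGroup E] [NormedSpace ℝ E] :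
    HasAP E ↔ ∀ K : Set E, IsCompact K → ∀ ε > 0, ∃ T : E →L[ℝ] E,
      FiniteDimensional ℝ (LinearMap.range T.toLinearMap) ∧ ∀ x ∈ K, ‖T x - x‖ < ε := by
  have h := (UniformConvergenceCLM.isEmbedding_coeFn (E := E) (F := E) (RingHom.id ℝ)
    {K : Set E | IsCompact K}).isInducing.eq_induced
  rw [HasAP, h, mem_closure_induced_compactConvergence_iff]
  simp only [exists_mem_image, mem_ofPred_eq]
  rfl

theorem hasLipAP_iff (X : Type*) [NormedAddCommGroup X] [NormedSpace ℝ X] :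
    HasLipAP X ↔ ∀ K : Set X, IsCompact K → ∀ ε > 0, ∃ f ∈ LipZero.finiteRank X X,
      ∀ x ∈ K, ‖f x - x‖ < ε :=
  mem_closure_induced_compactConvergence_iff _ _ _

theorem HasAP.of_equiv {E F : Type*} [NormedAddCommGroup E] [NormedSpace ℝ E]
    [NormedAddCommGroup F] [NormedSpace ℝ F] (e : E ≃L[ℝ] F) (h : HasAP E) : HasAP F := by
  rw [hasAP_iff] at h ⊢
  intro K hK ε hε
  obtain ⟨C, hC, hCe⟩ := (e : E →L[ℝ] F).bound
  obtain ⟨T, hT, hTK⟩ := h (e.symm '' K) (hK.image e.symm.continuous) (ε / C) (by positivity)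
  refine ⟨(e : E →L[ℝ] F) ∘L T ∘L (e.symm : F →L[ℝ] E), ?_, fun x hx => ?_⟩
  · have : LinearMap.range ((e : E →L[ℝ] F) ∘L T ∘L (e.symm : F →L[ℝ] E)).toLinearMap ≤
        (LinearMap.range T.toLinearMap).map (e : E →L[ℝ] F).toLinearMap := by
      rintro _ ⟨x, rfl⟩
      exact ⟨_, ⟨e.symm x, rfl⟩, rfl⟩
    exact Submodule.finiteDimensional_of_le this
  · calc ‖e (T (e.symm x)) - x‖ = ‖e (T (e.symm x) - e.symm x)‖ := by simp
      _ ≤ C * ‖T (e.symm x) - e.symm x‖ := hCe _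
      _ < C * (ε / C) := by gcongr; exact hTK _ ⟨x, hx, rfl⟩
      _ = ε := by field_simp

/-! ### Evaluation functionals, the free space and its barycenter map -/

namespace LipZero

variable {X : Type*} [NormedAddCommGroup X]

@[simp] theorem delta_apply (x : X) (f : LipZero X ℝ) : delta x f = f x := rfl

@[simp] theorem delta_zero : delta (0 : X) = 0 := by ext f; simp

theorem norm_delta_sub_le (x y : X) : ‖delta x - delta y‖ ≤ ‖x - y‖ :=
  ContinuousLinearMap.opNorm_le_bound _ (norm_nonneg _) fun f => by
    rw [mul_comm]; exact f.norm_sub_le x y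

/-- Continuous linear functionals are Lipschitz functions vanishing at `0`. -/
noncomputable def ofDual (X : Type*) [NormedAddCommGroup X] [NormedSpace ℝ X] :
    StrongDual ℝ X →L[ℝ] LipZero X ℝ :=
  LinearMap.mkContinuous
    { toFun := fun f => ⟨f, ⟨‖f‖, norm_nonneg _, fun x y => by
        rw [← map_sub]; exact f.le_opNorm _⟩, f.map_zero⟩
      map_add' := fun _ _ => rfl
      map_smul' := fun _ _ => rfl } 1
    fun f => by
      rw [one_mul]
      exact norm_le _ (norm_nonneg _) fun x y => by
        change ‖f x - f y‖ ≤ _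
        rw [← map_sub]; exact f.le_opNorm _

@[simp] theorem ofDual_apply [NormedSpace ℝ X] (f : StrongDual ℝ X) (x : X) :
    ofDual X f x = f x := rfl

end LipZero

/-- A closed subspace of the closed span of `s` that contains `s` is everything. -/
theorem Submodule.eq_top_of_isClosed_of_span_topologicalClosure {V : Type*}
    [NormedAddCommGroup V] [NormedSpace ℝ V] {s : Set V}
    (W : Submodule ℝ (Submodule.span ℝ s).topologicalClosure)
    (hW : IsClosed (W : Set (Submodule.span ℝ s).topologicalClosure))
    (h : ∀ v (hv : v ∈ (Submodule.span ℝ s).topologicalClosure), v ∈ s → ⟨v, hv⟩ ∈ W) :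
    W = ⊤ := by
  let F := (Submodule.span ℝ s).topologicalClosure
  have hF : IsClosed (F : Set V) := Submodule.isClosed_topologicalClosure _
  have hle : F ≤ W.map F.subtype := by
    refine Submodule.topologicalClosure_minimal _ (Submodule.span_le.2 fun v hv => ?_) ?_
    · have hvF : v ∈ F := Submodule.le_topologicalClosure _ (Submodule.subset_span hv)
      exact ⟨⟨v, hvF⟩, h v hvF hv, rfl⟩
    · rw [Submodule.map_coe]
      exact hF.isClosedEmbedding_subtypeVal.isClosedMap _ hW
  refine eq_top_iff.2 fun v _ => ?_
  obtain ⟨w, hw, hwv⟩ := hle v.2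
  rwa [← Subtype.ext hwv]

theorem LinearIsometry.isClosed_range {E F : Type*} [NormedAddCommGroup E] [NormedSpace ℝ E]
    [CompleteSpace E] [NormedAddCommGroup F] [NormedSpace ℝ F] (J : E →ₗᵢ[ℝ] F) :
    IsClosed (range J) :=
  J.isometry.isClosedEmbedding.isClosed_range

/-- The Lipschitz-free space as a type of its own, carrying only the instances that come from
its norm. -/
def FreeSpace (X : Type*) [NormedAddCommGroup X] : Type _ := ↥(LipFree X)

namespace FreeSpace

variable {X : Type*} [NormedAddCommGroup X]

noncomputable instance : NormedAddCommGroup (FreeSpace X) :=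
  inferInstanceAs (NormedAddCommGroup ↥(LipFree X))

noncomputable instance : NormedSpace ℝ (FreeSpace X) :=
  inferInstanceAs (NormedSpace ℝ ↥(LipFree X))

/-- The canonical embedding `x ↦ δ_x` of `X` into its Lipschitz-free space. -/
noncomputable def of (x : X) : FreeSpace X :=
  ⟨LipZero.delta x, Submodule.le_topologicalClosure _ (Submodule.subset_span ⟨x, rfl⟩)⟩

/-- The inclusion of the Lipschitz-free space into the dual of `Lip₀(X, ℝ)`. -/
noncomputable def incl (X : Type*) [NormedAddCommGroup X] :
    FreeSpace X →L[ℝ] StrongDual ℝ (LipZero X ℝ) :=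
  LinearMap.mkContinuous
    { toFun := fun μ => μ.1
      map_add' := fun _ _ => rfl
      map_smul' := fun _ _ => rfl } 1 fun μ => (one_mul ‖μ‖).ge

@[simp] theorem incl_of (x : X) : incl X (of x) = LipZero.delta x := rfl

@[simp] theorem of_zero : of (0 : X) = 0 := Subtype.ext LipZero.delta_zero

theorem norm_of_sub_le (x y : X) : ‖of x - of y‖ ≤ ‖x - y‖ := LipZero.norm_delta_sub_le x y

theorem continuous_of : Continuous (of (X := X)) :=
  (LipschitzWith.of_dist_le_mul (K := 1) fun x y => by
    rw [dist_eq_norm, dist_eq_norm, NNReal.coe_one, one_mul]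
    exact norm_of_sub_le x y).continuous

theorem eq_top_of_isClosed (W : Submodule ℝ (FreeSpace X)) (hW : IsClosed (W : Set (FreeSpace X)))
    (h : ∀ x, of x ∈ W) : W = ⊤ :=
  Submodule.eq_top_of_isClosed_of_span_topologicalClosure
    (V := StrongDual ℝ (LipZero X ℝ)) W hW (by rintro _ _ ⟨x, rfl⟩; exact h x)

theorem hom_ext {V : Type*} [NormedAddCommGroup V] [NormedSpace ℝ V]
    {φ ψ : FreeSpace X →L[ℝ] V} (h : ∀ x, φ (of x) = ψ (of x)) : φ = ψ := by
  have := eq_top_of_isClosed (LinearMap.ker (φ - ψ).toLinearMap) (φ - ψ).isClosed_ker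
    (fun x => by simp [h x])
  ext μ
  have hμ : μ ∈ LinearMap.ker (φ - ψ).toLinearMap := this ▸ Submodule.mem_top
  simpa [sub_eq_zero] using hμ

/-- The Lipschitz map `x ↦ L δ_x` attached to an operator `L` on the free space. -/
noncomputable def toLipZero {Y : Type*} [NormedAddCommGroup Y] [NormedSpace ℝ Y]
    (L : FreeSpace X →L[ℝ] Y) : LipZero X Y :=
  ⟨fun x => L (of x), ⟨‖L‖, norm_nonneg _, fun x y => by
    rw [← map_sub]
    exact L.le_opNorm_of_le (norm_of_sub_le x y)⟩, by simp⟩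

@[simp] theorem toLipZero_apply {Y : Type*} [NormedAddCommGroup Y] [NormedSpace ℝ Y]
    (L : FreeSpace X →L[ℝ] Y) (x : X) : toLipZero L x = L (of x) := rfl

/-- The dual of the Lipschitz-free space is `Lip₀(X, ℝ)`. -/
noncomputable def dualEquiv (X : Type*) [NormedAddCommGroup X] :
    LipZero X ℝ ≃L[ℝ] StrongDual ℝ (FreeSpace X) :=
  LinearEquiv.toContinuousLinearEquivOfBounds
    { toFun := fun f => (ContinuousLinearMap.apply ℝ ℝ f) ∘L incl X
      map_add' := fun f g => by ext; simp
      map_smul' := fun r f => by ext; simp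
      invFun := toLipZero
      left_inv := fun f => by ext; simp
      right_inv := fun φ => hom_ext fun x => by simp } 1 1
    (fun f => by
      rw [one_mul]
      refine ContinuousLinearMap.opNorm_le_bound _ (norm_nonneg _) fun μ => ?_
      rw [mul_comm]
      exact (incl X μ).le_opNorm f)
    (fun φ => by
      rw [one_mul]
      refine LipZero.norm_le _ (norm_nonneg _) fun x y => ?_
      change ‖φ (of x) - φ (of y)‖ ≤ _
      rw [← map_sub]
      exact φ.le_opNorm_of_le (norm_of_sub_le x y))

/-- The barycenter map: the linear retraction of `x ↦ δ_x` for a Banach space `X`. -/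
theorem exists_barycenter (X : Type*) [NormedAddCommGroup X] [NormedSpace ℝ X]
    [CompleteSpace X] : ∃ β : FreeSpace X →L[ℝ] X, ∀ x, β (of x) = x := by
  let J := NormedSpace.inclusionInDoubleDualLi (E := X) ℝ
  let r : FreeSpace X →L[ℝ] StrongDual ℝ (StrongDual ℝ X) :=
    (ContinuousLinearMap.precomp ℝ (LipZero.ofDual X)) ∘L incl X
  have hr : ∀ x, r (of x) = J x := fun x => by ext f; rfl
  -- `r` restricts a functional on `X^#` to `X*`, so it takes values in the bidual. Completeness of
  -- `X` makes its copy `J(X)` closed there; as `r` sends each `δ_x` into that copy, it sends all of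
  -- `F(X)` into it.
  let W : Submodule ℝ (FreeSpace X) := (LinearMap.range J.toLinearMap).comap r.toLinearMap
  have hJ : IsClosed (range J) :=
    LinearIsometry.isClosed_range (F := StrongDual ℝ (StrongDual ℝ X)) J
  have hW : W = ⊤ := eq_top_of_isClosed W (hJ.preimage r.continuous)
    fun x => ⟨x, (hr x).symm⟩
  have hmem : ∀ μ, r μ ∈ LinearMap.range J.toLinearMap := fun μ => by
    have : μ ∈ W := hW ▸ Submodule.mem_top
    exact this
  let e := J.equivRange
  refine ⟨(e.symm.toContinuousLinearEquiv : _ →L[ℝ] X) ∘L r.codRestrict _ hmem, fun x => ?_⟩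
  change e.symm _ = x
  rw [e.symm_apply_eq]
  exact Subtype.ext (hr x)

theorem hasAP_iff_lipFree : HasAP (FreeSpace X) ↔ HasAP (LipFree X) := Iff.rfl

end FreeSpace

theorem HasAP.hasLipAP {X : Type*} [NormedAddCommGroup X] [NormedSpace ℝ X] [CompleteSpace X]
    (h : HasAP (FreeSpace X)) : HasLipAP X := by
  rw [hasAP_iff] at h
  rw [hasLipAP_iff]
  intro K hK ε hε
  obtain ⟨β, hβ⟩ := FreeSpace.exists_barycenter X
  obtain ⟨C, hC, hCβ⟩ := β.bound
  obtain ⟨T, hT, hTK⟩ := h (FreeSpace.of '' K) (hK.image FreeSpace.continuous_of)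
    (ε / C) (by positivity)
  refine ⟨FreeSpace.toLipZero (β ∘L T), ?_, fun x hx => ?_⟩
  · have : Submodule.span ℝ (range (FreeSpace.toLipZero (β ∘L T))) ≤
        (LinearMap.range T.toLinearMap).map β.toLinearMap := by
      rw [Submodule.span_le]
      rintro _ ⟨x, rfl⟩
      exact ⟨_, ⟨FreeSpace.of x, rfl⟩, rfl⟩
    exact Submodule.finiteDimensional_of_le this
  · calc ‖FreeSpace.toLipZero (β ∘L T) x - x‖ = ‖β (T (FreeSpace.of x) - FreeSpace.of x)‖ := by
          simp [hβ]
      _ ≤ C * ‖T (FreeSpace.of x) - FreeSpace.of x‖ := hCβ _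
      _ < C * (ε / C) := by gcongr; exact hTK _ ⟨x, hx, rfl⟩
      _ = ε := by field_simp

/-! ### Compact sets and null families -/

open scoped ZeroAtInfty

/-- Every compact set is controlled by a family of vectors tending to zero. -/
theorem IsCompact.exists_tendsto_zero_dominating {E : Type*} [NormedAddCommGroup E]
    [NormedSpace ℝ E] {K : Set E} (hK : IsCompact K) :
    ∃ (s : Set (ℕ × E)) (z : s → E), Tendsto z cofinite (𝓝 0) ∧
      ∀ (T : E →L[ℝ] E) (δ : ℝ), (∀ i, ‖T (z i)‖ ≤ δ) → ∀ x ∈ K, ‖T x‖ ≤ 2 * δ := by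
  obtain ⟨R, hR, hKR⟩ : ∃ R > 0, ∀ x ∈ K, ‖x‖ ≤ R := hK.isBounded.exists_pos_norm_le
  have hnet : ∀ k : ℕ, ∃ t : Set E, t.Finite ∧ ∀ x ∈ K, ∃ p ∈ t, ‖x - p‖ ≤ R * (1 / 4) ^ k ∧
      (k = 0 → p = 0) := by
    intro k
    rcases Nat.eq_zero_or_pos k with rfl | hk
    -- The net at level 0 is `{0}`, so that the telescoping sum for `x` starts at 0.
    · exact ⟨{0}, finite_singleton 0, fun x hx => ⟨0, rfl, by simpa using hKR x hx, fun _ => rfl⟩⟩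
    · obtain ⟨t, -, htf, ht⟩ := hK.finite_cover_balls (e := R * (1 / 4) ^ k) (by positivity)
      refine ⟨t, htf, fun x hx => ?_⟩
      obtain ⟨p, hp, hxp⟩ := mem_iUnion₂.1 (ht hx)
      exact ⟨p, hp, by simpa [dist_eq_norm] using (Metric.mem_ball.1 hxp).le, fun h => by omega⟩
  choose N hNf hN using hnet
  -- Each `x ∈ K` is a sum of differences `y` of successive net points, with `‖y‖ ≤ 2R·4⁻ᵏ`. The
  -- vectors `2ᵏ y` still tend to 0, and the weights `2⁻ᵏ` left over sum to the factor 2. Indexing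
  -- by pairs `(k, y)` keeps each level finite.
  let F : ℕ → Set E := fun k =>
    image2 (fun p q => p - q) (N (k + 1)) (N k) ∩ {y | ‖y‖ ≤ 2 * R * (1 / 4) ^ k}
  have hF : ∀ k, (F k).Finite := fun k => ((hNf (k + 1)).image2 _ (hNf k)).inter_of_left _
  refine ⟨{q | q.2 ∈ F q.1}, fun i => (2 : ℝ) ^ i.1.1 • i.1.2, ?_, ?_⟩
  · rw [tendsto_zero_iff_norm_tendsto_zero, Metric.tendsto_nhds]
    intro ε hε
    have hlim : Tendsto (fun n : ℕ => 2 * R * (1 / 2 : ℝ) ^ n) atTop (𝓝 (2 * R * 0)) :=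
      (tendsto_pow_atTop_nhds_zero_of_lt_one (by norm_num) (by norm_num)).const_mul _
    rw [mul_zero] at hlim
    obtain ⟨n, hn⟩ := eventually_atTop.1 (hlim.eventually_lt_const hε)
    have hfin : (⋃ k ∈ Finset.range n, ({k} : Set ℕ) ×ˢ F k).Finite :=
      (Finset.range n).finite_toSet.biUnion fun k _ => (finite_singleton k).prod (hF k)
    refine (hfin.preimage Subtype.val_injective.injOn).subset ?_
    rintro ⟨⟨k, y⟩, hy⟩ hbad
    by_contra hk
    refine hbad ?_
    have hnk : n ≤ k := by
      by_contra! hlt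
      exact hk (by simpa using ⟨hlt, hy⟩)
    change dist ‖(2 : ℝ) ^ k • y‖ 0 < ε
    rw [Real.dist_0_eq_abs, abs_norm, norm_smul, norm_pow, Real.norm_ofNat]
    calc (2 : ℝ) ^ k * ‖y‖ ≤ 2 ^ k * (2 * R * (1 / 4) ^ k) := by gcongr; exact hy.2
      _ = 2 * R * (1 / 2) ^ k := by
        rw [mul_left_comm, ← mul_pow]; norm_num
      _ < ε := hn k hnk
  · intro T δ hT x hx
    choose p hpN hpx hp0 using fun k => hN k x hx
    have hstep : ∀ k, ‖T (p (k + 1) - p k)‖ ≤ δ * (1 / 2) ^ k := by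
      intro k
      have hmem : p (k + 1) - p k ∈ F k := by
        refine ⟨⟨_, hpN _, _, hpN _, rfl⟩, ?_⟩
        calc ‖p (k + 1) - p k‖ = ‖(x - p k) - (x - p (k + 1))‖ := by congr 1; abel
          _ ≤ R * (1 / 4) ^ k + R * (1 / 4) ^ (k + 1) :=
            (norm_sub_le _ _).trans (add_le_add (hpx _) (hpx _))
          _ ≤ 2 * R * (1 / 4) ^ k := by
            have : 0 < R * (1 / 4) ^ k := by positivity
            rw [pow_succ]; linarith
      have h := hT ⟨(k, p (k + 1) - p k), hmem⟩
      simp only [map_smul, norm_smul, norm_pow, Real.norm_ofNat] at h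
      rw [one_div, inv_pow, ← div_eq_mul_inv, le_div_iff₀ (by positivity), mul_comm]
      exact h
    have hδ : 0 ≤ δ := by simpa using (norm_nonneg _).trans (hstep 0)
    have hsum : ∀ k, ‖T (p k)‖ ≤ 2 * δ - 2 * δ * (1 / 2) ^ k := by
      intro k
      induction k with
      | zero => simp [hp0 0 rfl]
      | succ k ih =>
        calc ‖T (p (k + 1))‖ = ‖T (p (k + 1) - p k) + T (p k)‖ := by rw [← map_add]; simp
          _ ≤ δ * (1 / 2) ^ k + (2 * δ - 2 * δ * (1 / 2) ^ k) :=
            (norm_add_le _ _).trans (add_le_add (hstep k) ih)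
          _ = 2 * δ - 2 * δ * (1 / 2) ^ (k + 1) := by rw [pow_succ]; ring
    have hlim : Tendsto p atTop (𝓝 x) := by
      rw [tendsto_iff_norm_sub_tendsto_zero]
      refine squeeze_zero (fun _ => norm_nonneg _)
        (fun k => (norm_sub_rev _ _).trans_le (hpx k)) ?_
      simpa using (tendsto_pow_atTop_nhds_zero_of_lt_one (r := (1 / 4 : ℝ)) (by norm_num)
        (by norm_num)).const_mul R
    refine le_of_tendsto ((T.continuous.tendsto x).comp hlim).norm (.of_forall fun k => ?_)
    have : 0 ≤ 2 * δ * (1 / 2) ^ k := by positivity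
    exact (hsum k).trans (by linarith)

/-! ### The space `c₀(E)` and its functionals -/

namespace ZeroAtInftyContinuousMap

variable {ι E : Type*} [TopologicalSpace ι] [NormedAddCommGroup E]

theorem norm_apply_le (w : C₀(ι, E)) (i : ι) : ‖w i‖ ≤ ‖w‖ := w.toBCF.norm_coe_le_norm i

theorem norm_le_of_forall {w : C₀(ι, E)} {c : ℝ} (hc : 0 ≤ c) (h : ∀ i, ‖w i‖ ≤ c) : ‖w‖ ≤ c :=
  (BoundedContinuousFunction.norm_le (f := w.toBCF) hc).2 h

theorem coe_sum {κ : Type*} (s : Finset κ) (w : κ → C₀(ι, E)) (i : ι) :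
    (∑ k ∈ s, w k) i = ∑ k ∈ s, w k i := by
  classical
  induction s using Finset.induction_on with
  | empty => simp
  | insert k s hk ih => simp [Finset.sum_insert hk, ih]

variable [DiscreteTopology ι]

/-- A family on a discrete space tending to zero, as a function vanishing at infinity. -/
def ofTendsto (w : ι → E) (hw : Tendsto w cofinite (𝓝 0)) : C₀(ι, E) where
  toFun := w
  continuous_toFun := continuous_of_discreteTopology
  zero_at_infty' := by rwa [cocompact_eq_cofinite]

@[simp] theorem ofTendsto_apply (w : ι → E) (hw : Tendsto w cofinite (𝓝 0)) (i : ι) :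
    ofTendsto w hw i = w i := rfl

variable [DecidableEq ι] [NormedSpace ℝ E]

/-- The family supported at `i` with a given value there. -/
noncomputable def single (i : ι) : E →L[ℝ] C₀(ι, E) :=
  LinearMap.mkContinuous
    { toFun := fun v => ofTendsto (Pi.single i v) <| tendsto_nhds_of_eventually_eq <|
        (finite_singleton i).subset fun j hj => by
          by_contra hne
          exact hj (Pi.single_eq_of_ne (M := fun _ => E) hne v)
      map_add' := fun v w => by ext j; simp [Pi.single_add]
      map_smul' := fun r v => by ext j; simp [Pi.single_smul] } 1
    fun v => by
      rw [one_mul]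
      refine norm_le_of_forall (norm_nonneg _) fun j => ?_
      rcases eq_or_ne j i with rfl | h <;> simp [*]

theorem single_apply (i : ι) (v : E) (j : ι) :
    single i v j = (Pi.single i v : ι → E) j := rfl

theorem sum_single_apply (s : Finset ι) (v : ι → E) (j : ι) :
    (∑ i ∈ s, single i (v i)) j = if j ∈ s then v j else 0 := by
  simp [coe_sum, single_apply, Pi.single_apply]

theorem hasSum_single (w : C₀(ι, E)) : HasSum (fun i => single i (w i)) w := by
  rw [HasSum, Metric.tendsto_nhds]
  intro ε hε
  have hw : Tendsto w cofinite (𝓝 0) := by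
    rw [← cocompact_eq_cofinite]; exact w.zero_at_infty'
  have hfin : {i | ¬ ‖w i‖ < ε / 2}.Finite :=
    hw.norm.eventually_lt_const (by rw [norm_zero]; positivity)
  rw [SummationFilter.unconditional_filter, eventually_atTop]
  refine ⟨hfin.toFinset, fun s hs => ?_⟩
  rw [dist_eq_norm]
  refine (norm_le_of_forall (half_pos hε).le fun j => ?_).trans_lt (half_lt_self hε)
  rw [sub_apply, sum_single_apply]
  split_ifs with hj
  · simpa using (half_pos hε).le
  · have : ‖w j‖ < ε / 2 := by
      by_contra h
      exact hj (hs (hfin.mem_toFinset.2 h))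
    simpa using this.le

/-- Almost norming vectors from the unit ball, placed at finitely many indices, form a family of sup
norm at most 1, so `‖Λ‖` bounds every finite sum. With `hasSum_single` this represents `Λ` by an
`ℓ¹` family in `E*`. -/
theorem summable_norm_comp_single (Λ : C₀(ι, E) →L[ℝ] ℝ) :
    Summable fun i => ‖Λ ∘L single i‖ := by
  refine summable_of_sum_le (c := ‖Λ‖) (fun _ => norm_nonneg _) fun s => ?_
  refine le_of_forall_pos_le_add fun ε hε => ?_
  -- The `+ 1` covers empty `s`.
  let η := ε / (s.card + 1)
  have hη : 0 < η := by positivity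
  have hv : ∀ i, ∃ v : E, ‖v‖ ≤ 1 ∧ ‖Λ ∘L single i‖ - η ≤ Λ (single i v) := by
    intro i
    obtain ⟨v, hv, hlt⟩ := (Λ ∘L single i).exists_lt_apply_of_lt_opNorm (sub_lt_self _ hη)
    rw [Real.norm_eq_abs] at hlt
    rcases abs_choice ((Λ ∘L single i) v) with h | h
    · exact ⟨v, hv.le, by rw [h] at hlt; exact hlt.le⟩
    · exact ⟨-v, by simpa using hv.le, by rw [h] at hlt; simpa using hlt.le⟩
  choose v hv1 hv using hv
  have hle : ∑ i ∈ s, (‖Λ ∘L single i‖ - η) ≤ ‖Λ‖ :=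
    calc ∑ i ∈ s, (‖Λ ∘L single i‖ - η) ≤ ∑ i ∈ s, Λ (single i (v i)) :=
          Finset.sum_le_sum fun i _ => hv i
      _ = Λ (∑ i ∈ s, single i (v i)) := (map_sum _ _ _).symm
      _ ≤ ‖Λ‖ * ‖∑ i ∈ s, single i (v i)‖ := (le_abs_self _).trans (Λ.le_opNorm _)
      _ ≤ ‖Λ‖ * 1 := by
        gcongr
        refine norm_le_of_forall zero_le_one fun j => ?_
        rw [sum_single_apply]
        split_ifs
        · exact hv1 j
        · simp
      _ = ‖Λ‖ := mul_one _
  have hcard : s.card * η ≤ ε := by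
    rw [mul_div_assoc', div_le_iff₀ (by positivity)]
    nlinarith
  rw [Finset.sum_sub_distrib, Finset.sum_const, nsmul_eq_mul] at hle
  linarith

end ZeroAtInftyContinuousMap

/-! ### Vanishing traces and Grothendieck's duality theorem -/

theorem ContinuousLinearMap.exists_eq_sum_of_finiteDimensional_range {V : Type*}
    [NormedAddCommGroup V] [NormedSpace ℝ V] (S : V →L[ℝ] V)
    [FiniteDimensional ℝ (LinearMap.range S.toLinearMap)] :
    ∃ (n : ℕ) (φ : Fin n → StrongDual ℝ V) (g : Fin n → V), ∀ v, S v = ∑ j, φ j v • g j := by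
  let W := LinearMap.range S.toLinearMap
  let β := Module.finBasis ℝ W
  let S' : V →L[ℝ] W := S.codRestrict W fun v => ⟨v, rfl⟩
  refine ⟨_, fun j => (LinearMap.toContinuousLinearMap (β.coord j)) ∘L S', fun j => β j,
    fun v => ?_⟩
  have := congrArg W.subtype (β.sum_repr (S' v))
  rw [map_sum] at this
  exact this.symm

/-- If the dual of `E` has the approximation property, a nuclear operator that vanishes on `E` has
trace zero. -/
theorem HasAP.tsum_apply_eq_zero {ι E : Type*} [NormedAddCommGroup E] [NormedSpace ℝ E]
    (h : HasAP (StrongDual ℝ E)) {a : ι → StrongDual ℝ E} (ha : Summable fun i => ‖a i‖)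
    {z : ι → E} (hz : Tendsto z cofinite (𝓝 0))
    (haz : ∀ (f : StrongDual ℝ E) (x : E), ∑' i, a i (f (z i) • x) = 0) :
    ∑' i, a i (z i) = 0 := by
  obtain ⟨B, hB, hzB⟩ : ∃ B > 0, ∀ i, √‖z i‖ ≤ B := by
    have hbdd : Bornology.IsBounded (range z) :=
      hz.isCompact_insert_range_of_cofinite.isBounded.subset (subset_insert _ _)
    obtain ⟨B, hB, hzB⟩ := hbdd.exists_pos_norm_le
    exact ⟨√B, Real.sqrt_pos.2 hB, fun i => Real.sqrt_le_sqrt (hzB _ ⟨i, rfl⟩)⟩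
  -- The square root shares the decay of `z`: `aᵢ(zᵢ) = ‖aᵢ‖ bᵢ(uᵢ)` with `u` bounded and `b` null
  -- in `E*`, so `{bᵢ} ∪ {0}` is a compact set on which to approximate the identity of `E*`.
  let c : ι → ℝ := fun i => √‖z i‖
  let u : ι → E := fun i => (c i)⁻¹ • z i
  let b : ι → StrongDual ℝ E := fun i => (c i * ‖a i‖⁻¹) • a i
  have hcu : ∀ i, c i • u i = z i := fun i => by
    rcases eq_or_ne (z i) 0 with h0 | h0
    · simp [u, h0]
    · exact smul_inv_smul₀ (Real.sqrt_pos.2 (norm_pos_iff.2 h0)).ne' _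
  have hu : ∀ i, ‖u i‖ ≤ B := fun i => by
    refine le_trans (le_of_eq ?_) (hzB i)
    rw [norm_smul, norm_inv, Real.norm_of_nonneg (Real.sqrt_nonneg _), ← div_eq_inv_mul]
    exact Real.div_sqrt
  have hab : ∀ i, ‖a i‖ • b i = c i • a i := fun i => by
    rcases eq_or_ne (a i) 0 with h0 | h0
    · simp [h0]
    · rw [smul_smul, mul_left_comm, mul_inv_cancel₀ (norm_ne_zero_iff.2 h0), mul_one]
  have hb : Tendsto b cofinite (𝓝 0) := by
    rw [tendsto_zero_iff_norm_tendsto_zero]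
    have hc : Tendsto c cofinite (𝓝 0) := by
      have := (Real.continuous_sqrt.tendsto _).comp hz.norm
      rwa [norm_zero, Real.sqrt_zero] at this
    refine squeeze_zero (fun _ => norm_nonneg _) (fun i => ?_) hc
    rw [norm_smul, norm_mul, Real.norm_of_nonneg (Real.sqrt_nonneg _), norm_inv, norm_norm,
      mul_assoc]
    exact mul_le_of_le_one_right (Real.sqrt_nonneg _) (inv_mul_le_one)
  have hS0 : ∀ S : StrongDual ℝ E →L[ℝ] StrongDual ℝ E,
      FiniteDimensional ℝ (LinearMap.range S.toLinearMap) →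
      HasSum (fun i => ‖a i‖ * S (b i) (u i)) 0 := by
    intro S hS
    obtain ⟨n, φ, g, hSφ⟩ := S.exists_eq_sum_of_finiteDimensional_range
    -- `haz` gives only pointwise vanishing. Absolute convergence upgrades it to a norm-convergent
    -- sum in `E*`, to which the functionals `φ j` of `E**` can be applied.
    have hterm : ∀ g : StrongDual ℝ E, HasSum (fun i => g (z i) • a i) 0 := by
      intro g
      have hsum : Summable fun i => g (z i) • a i := by
        refine Summable.of_norm_bounded (ha.mul_left (‖g‖ * B ^ 2)) fun i => ?_
        rw [norm_smul]
        gcongr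
        refine (g.le_opNorm _).trans ?_
        gcongr
        rw [← Real.sq_sqrt (norm_nonneg (z i))]
        exact pow_le_pow_left₀ (Real.sqrt_nonneg _) (hzB i) 2
      convert hsum.hasSum
      ext x
      have := (hsum.hasSum.mapL (ContinuousLinearMap.apply ℝ ℝ x)).tsum_eq
      rw [ContinuousLinearMap.apply_apply] at this
      rw [zero_apply, ← this]
      simpa using (haz g x).symm
    have hj : ∀ j, HasSum (fun i => ‖a i‖ * (φ j (b i) * g j (u i))) 0 := by
      intro j
      have := (hterm (g j)).mapL (φ j)
      rw [map_zero] at this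
      refine this.congr_fun ?_
      intro i
      have h1 : ‖a i‖ * φ j (b i) = c i * φ j (a i) := by
        simpa using congrArg (φ j) (hab i)
      rw [← mul_assoc, h1, ← hcu i]
      simp
      ring
    have := hasSum_sum (s := Finset.univ) fun j _ => hj j
    simpa [hSφ, Finset.mul_sum] using this
  have haz_sum : Summable fun i => a i (z i) := by
    refine Summable.of_norm_bounded (ha.mul_right (B ^ 2)) fun i => ?_
    refine ((a i).le_opNorm _).trans ?_
    gcongr
    rw [← Real.sq_sqrt (norm_nonneg (z i))]
    exact pow_le_pow_left₀ (Real.sqrt_nonneg _) (hzB i) 2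
  have hbound : ∀ ε > 0, |∑' i, a i (z i)| ≤ ε * (B * ∑' i, ‖a i‖) := by
    intro ε hε
    obtain ⟨S, hS, hSb⟩ := (hasAP_iff _).1 h _ hb.isCompact_insert_range_of_cofinite ε hε
    have hdiff := haz_sum.hasSum.sub (hS0 S hS)
    rw [sub_zero] at hdiff
    rw [← hdiff.tsum_eq, ← Real.norm_eq_abs]
    refine (tsum_of_norm_bounded (ha.hasSum.mul_left (ε * B)) fun i => ?_).trans_eq
      (mul_assoc _ _ _)
    have h1 : a i (z i) = ‖a i‖ * b i (u i) := by
      have := congrArg (fun f : StrongDual ℝ E => f (u i)) (hab i)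
      simp only [smul_apply, smul_eq_mul] at this
      rw [this, ← smul_eq_mul, ← map_smul, hcu i]
    rw [h1, ← mul_sub, norm_mul, norm_norm, mul_comm]
    gcongr
    rw [norm_sub_rev, ← sub_apply]
    exact ((S (b i) - b i).le_opNorm _).trans
      (mul_le_mul (hSb _ (mem_insert_of_mem _ ⟨i, rfl⟩)).le (hu i) (norm_nonneg _) hε.le)
  have hlim : Tendsto (fun ε : ℝ => ε * (B * ∑' i, ‖a i‖)) (𝓝[>] 0) (𝓝 0) := by
    have : Continuous fun ε : ℝ => ε * (B * ∑' i, ‖a i‖) := by fun_prop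
    simpa using (this.tendsto 0).mono_left nhdsWithin_le_nhds
  have := ge_of_tendsto hlim (eventually_mem_nhdsWithin.mono fun ε hε => hbound ε hε)
  exact abs_nonpos_iff.1 this

theorem Submodule.exists_dual_eq_zero_of_notMem_closure {V : Type*} [NormedAddCommGroup V]
    [NormedSpace ℝ V] (M : Submodule ℝ V) {v : V} (hv : v ∉ closure (M : Set V)) :
    ∃ Λ : StrongDual ℝ V, (∀ w ∈ M, Λ w = 0) ∧ Λ v ≠ 0 := by
  obtain ⟨Λ, r, hΛ, hr⟩ := geometric_hahn_banach_closed_point M.convex.closure isClosed_closure hv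
  have hM : ∀ w ∈ M, Λ w < r := fun w hw => hΛ w (subset_closure hw)
  have hr0 : 0 < r := by simpa using hM 0 M.zero_mem
  refine ⟨Λ, fun w hw => ?_, (hr0.trans hr).ne'⟩
  by_contra h0
  -- If `Λ w ≠ 0`, a multiple of `w` attains the strict bound `r`.
  have := hM ((r / Λ w) • w) (M.smul_mem _ hw)
  rw [map_smul, smul_eq_mul, div_mul_cancel₀ _ h0] at this
  exact this.false

/-- A normed space whose dual has the approximation property has it too. -/
theorem HasAP.of_dual {E : Type*} [NormedAddCommGroup E] [NormedSpace ℝ E]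
    (h : HasAP (StrongDual ℝ E)) : HasAP E := by
  classical
  rw [hasAP_iff]
  intro K hK ε hε
  obtain ⟨s, z, hz, hzK⟩ := hK.exists_tendsto_zero_dominating
  -- With the discrete topology, vanishing at infinity means tending to 0 along `cofinite`.
  let : TopologicalSpace s := ⊥
  have : DiscreteTopology s := ⟨rfl⟩
  have hTz : ∀ T : E →L[ℝ] E, Tendsto (fun i => T (z i)) cofinite (𝓝 0) := fun T => by
    have := (T.continuous.tendsto 0).comp hz
    rwa [map_zero] at this
  let Φ : (E →L[ℝ] E) →ₗ[ℝ] C₀(s, E) :=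
    { toFun := fun T => .ofTendsto _ (hTz T)
      map_add' := fun _ _ => rfl
      map_smul' := fun _ _ => rfl }
  let M : Submodule ℝ C₀(s, E) :=
    Submodule.span ℝ {w | ∃ (f : StrongDual ℝ E) (x : E), Φ (f.smulRight x) = w}
  have hM : ∀ w ∈ M, ∃ T : E →L[ℝ] E,
      FiniteDimensional ℝ (LinearMap.range T.toLinearMap) ∧ Φ T = w := by
    intro w hw
    induction hw using Submodule.span_induction with
    | mem w hw =>
      obtain ⟨f, x, rfl⟩ := hw
      refine ⟨_, Submodule.finiteDimensional_of_le (S₂ := Submodule.span ℝ {x}) ?_, rfl⟩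
      rintro _ ⟨y, rfl⟩
      exact Submodule.smul_mem _ _ (Submodule.mem_span_singleton_self x)
    | zero =>
      refine ⟨0, Submodule.finiteDimensional_of_le (S₂ := ⊥) ?_, map_zero Φ⟩
      rintro _ ⟨y, rfl⟩
      exact Submodule.zero_mem _
    | add w w' _ _ hw hw' =>
      obtain ⟨T, hT, rfl⟩ := hw
      obtain ⟨T', hT', rfl⟩ := hw'
      refine ⟨T + T', Submodule.finiteDimensional_of_le
        (S₂ := LinearMap.range T.toLinearMap ⊔ LinearMap.range T'.toLinearMap) ?_, map_add Φ _ _⟩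
      rintro _ ⟨y, rfl⟩
      exact Submodule.add_mem_sup ⟨y, rfl⟩ ⟨y, rfl⟩
    | smul r w _ hw =>
      obtain ⟨T, hT, rfl⟩ := hw
      refine ⟨r • T, Submodule.finiteDimensional_of_le
        (S₂ := LinearMap.range T.toLinearMap) ?_, map_smul Φ _ _⟩
      rintro _ ⟨y, rfl⟩
      exact Submodule.smul_mem _ _ ⟨y, rfl⟩
  by_cases hcl : Φ (ContinuousLinearMap.id ℝ E) ∈ closure (M : Set C₀(s, E))
  -- `hzK` doubles the error, and `ε / 2 < ε` restores strictness.
  · obtain ⟨w, hw, hdist⟩ := Metric.mem_closure_iff.1 hcl (ε / 4) (by positivity)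
    obtain ⟨T, hT, rfl⟩ := hM w hw
    refine ⟨T, hT, fun x hx => ?_⟩
    rw [dist_comm, dist_eq_norm, ← map_sub] at hdist
    have := hzK (T - ContinuousLinearMap.id ℝ E) (ε / 4)
      (fun i => (ZeroAtInftyContinuousMap.norm_apply_le
        (Φ (T - ContinuousLinearMap.id ℝ E)) i).trans hdist.le) x hx
    rw [sub_apply, ContinuousLinearMap.id_apply] at this
    linarith
  · obtain ⟨Λ, hΛM, hΛ⟩ := M.exists_dual_eq_zero_of_notMem_closure hcl
    have hrep : ∀ T : E →L[ℝ] E,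
        ∑' i, (Λ ∘L ZeroAtInftyContinuousMap.single i) (T (z i)) = Λ (Φ T) := fun T =>
      ((ZeroAtInftyContinuousMap.hasSum_single (Φ T)).mapL Λ).tsum_eq
    refine absurd ?_ hΛ
    rw [← hrep]
    refine h.tsum_apply_eq_zero (ZeroAtInftyContinuousMap.summable_norm_comp_single Λ) hz
      fun f x => ?_
    exact (hrep (f.smulRight x)).trans (hΛM _ (Submodule.subset_span ⟨f, x, rfl⟩))

theorem proposition2p5 (X : Type*) [NormedAddCommGroup X] [NormedSpace ℝ X] [CompleteSpace X] :
    (HasAP (LipFree X) → HasLipAP X) ∧ (HasAP (LipZero X ℝ) → HasLipAP X) :=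
  ⟨fun h => (FreeSpace.hasAP_iff_lipFree.2 h).hasLipAP,
    fun h => (h.of_equiv (FreeSpace.dualEquiv X)).of_dual.hasLipAP⟩
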